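/- Let $p$ be a prime, $k$ a field of characteristic $p$, and $G$ a group of order $p^n$ whose Frattini subgroup $\Phi(G)$ has order $p$. Let $t(G)$ denote the nilpotency index of the Jacobson radical $J(kG)$ of the group algebra $kG$, that is, the smallest positive integer $s$ such that $J(kG)^s = 0$. Then the exponent of $G$ is $p$ or $p^2$, and \[ t(G) = \begin{cases} (n+1)(p-1)+1 & \text{if $G$ has exponent $p$,} \\ (p+n-1)(p-1)+1 & \text{if $G$ has exponent $p^2$.} \end{cases} \] In particular, if $p=2$ then $t(G)=n+2$. -/

import Mathlib

/-- The nilpotency index of the Jacobson radical of a ring `A`: the smallest positive integer `s`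
with `J(A) ^ s = 0`. (It is `0` if the radical is not nilpotent.) -/
noncomputable def radicalNilpotencyIndex (A : Type*) [Ring A] : ℕ :=
  sInf {s : ℕ | 0 < s ∧ Ring.jacobson A ^ s = ⊥}

/-- `t(G)`, relative to a coefficient field `k`: the nilpotency index of the Jacobson radical
of the group algebra `kG`. -/
noncomputable def groupNilpotencyIndex (k G : Type*) [Field k] [Group G] : ℕ :=
  radicalNilpotencyIndex (MonoidAlgebra k G)

/-!
A finite `p`-group `G` is nilpotent, so `Φ(G)`, being normal of order `p`, is central; let `z`
generate it. The radical of `kG` is the augmentation ideal `I`, and `z - 1` lies in `I ^ w`, with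
`w = 2` if `G` has exponent `p` (`z` may be taken to be a commutator) and `w = p` if `G` has
exponent `p ^ 2` (`z` may be taken to be a `p`-th power).

Upper bound: `I` is generated by `n - 1` elements `g - 1`, where `g` runs through generators of `G`.
A word in them of length `m > (n - 1) * (p - 1)` contains some letter `p` times. Collecting these
letters and replacing their product `(g - 1) ^ p = g ^ p - 1` only introduces multiples of `z - 1`,
so `I ^ m ≤ I ^ (m - w) * (z - 1)`; iterate this, and use `(z - 1) ^ p = 0`.

Lower bound: along a chain of subgroups from `1` through `Φ(G)` to `G` with all indices `p`, the sum
of the elements of a subgroup gains at each step a factor `∑ i < p, g ^ i = (g - 1) ^ (p - 1)`. The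
sum of all elements of `G` is therefore a nonzero element of `I ^ ((n - 1 + w) * (p - 1))`.
-/

section Frattini

variable {G : Type*} [Group G] {p : ℕ}

theorem normal_of_isCoatom [Group.IsNilpotent G] {M : Subgroup G} (hM : IsCoatom M) : M.Normal :=
  Subgroup.NormalizerCondition.normal_of_coatom M Group.normalizerCondition_of_isNilpotent hM

theorem isSimpleGroup_quotient_of_isCoatom {M : Subgroup G} [M.Normal] (hM : IsCoatom M) :
    IsSimpleGroup (G ⧸ M) := by
  have : IsSimpleOrder (Set.Ici M) := Set.isSimpleOrder_Ici_iff_isCoatom.2 hM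
  have : IsSimpleOrder (Subgroup (G ⧸ M)) :=
    (QuotientGroup.comapMk'OrderIso M).isSimpleOrder (β := Set.Ici M)
  have : Nontrivial (G ⧸ M) := Subgroup.nontrivial_iff.1 inferInstance
  exact ⟨fun H _ => eq_bot_or_eq_top H⟩

theorem index_eq_of_isCoatom [Fact p.Prime] [Group.IsNilpotent G] (hG : IsPGroup p G)
    {M : Subgroup G} (hM : IsCoatom M) : M.index = p := by
  have := normal_of_isCoatom hM
  have := isSimpleGroup_quotient_of_isCoatom hM
  have hprime : (Nat.card (G ⧸ M)).Prime := IsSimpleGroup.prime_card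
  rcases (hG.to_quotient M).card_eq_or_dvd with h | h
  · exact absurd h hprime.ne_one
  · exact ((Nat.prime_dvd_prime_iff_eq Fact.out hprime).1 h).symm

theorem le_frattini_iff {H : Subgroup G} :
    H ≤ frattini G ↔ ∀ M : Subgroup G, IsCoatom M → H ≤ M := by
  simp only [frattini, Order.radical, le_iInf_iff, Set.mem_ofPred_eq]

theorem commutator_le_frattini [Group.IsNilpotent G] : commutator G ≤ frattini G := by
  refine le_frattini_iff.2 fun M hM => ?_
  have := normal_of_isCoatom hM
  have := isSimpleGroup_quotient_of_isCoatom hM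
  exact Subgroup.Normal.quotient_commutative_iff_commutator_le.1 inferInstance

theorem pow_mem_frattini [Fact p.Prime] [Group.IsNilpotent G] (hG : IsPGroup p G) (g : G) :
    g ^ p ∈ frattini G := by
  refine Subgroup.zpowers_le.1 (le_frattini_iff.2 fun M hM => Subgroup.zpowers_le.2 ?_)
  have := normal_of_isCoatom hM
  exact index_eq_of_isCoatom hG hM ▸ M.pow_index_mem g

theorem frattini_eq_bot [IsCoatomic (Subgroup G)] [ComplementedLattice (Subgroup G)] :
    frattini G = ⊥ := by
  obtain ⟨K, hK⟩ := exists_isCompl (frattini G)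
  have hK_top : K = ⊤ := frattini_nongenerating hK.symm.sup_eq_top
  exact eq_bot_of_top_isCompl (hK_top ▸ hK.symm)

theorem complementedLattice_subgroup_of_pow_eq_one {G : Type*} [CommGroup G] [Fact p.Prime]
    (hG : ∀ g : G, g ^ p = 1) : ComplementedLattice (Subgroup G) :=
  let := AddCommGroup.zmodModule (G := Additive G) hG
  (Subgroup.toAddSubgroup.trans (AddSubgroup.toZModSubmodule p)).symm.complementedLattice

open scoped commutatorElement in
theorem exists_commutatorElement_ne_one [Fact p.Prime] [IsCoatomic (Subgroup G)]
    (hG : ∀ g : G, g ^ p = 1) (hΦ : frattini G ≠ ⊥) : ∃ g h : G, ⁅g, h⁆ ≠ 1 := by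
  by_contra! hcomm
  let : CommGroup G := { mul_comm g h := commutatorElement_eq_one_iff_mul_comm.1 (hcomm g h) }
  have := complementedLattice_subgroup_of_pow_eq_one hG
  exact hΦ frattini_eq_bot

end Frattini

section PrimeOrder

variable {G : Type*} [Group G] {p : ℕ} [Fact p.Prime]

theorem zpowers_eq_of_prime_card {H : Subgroup G} (hH : Nat.card H = p) {z : G} (hz : z ∈ H)
    (hz1 : z ≠ 1) : Subgroup.zpowers z = H := by
  have htop := zpowers_eq_top_of_prime_card hH (g := ⟨z, hz⟩) (by simpa using hz1)
  simpa [MonoidHom.map_zpowers, ← MonoidHom.range_eq_map] using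
    congrArg (Subgroup.map H.subtype) htop

theorem le_center_of_card_eq (hG : IsPGroup p G) {N : Subgroup G} [N.Normal]
    (hN : Nat.card N = p) : N ≤ Subgroup.center G := by
  have : Finite N := Nat.finite_of_card_ne_zero (hN ▸ (Fact.out : p.Prime).ne_zero)
  have hone : (1 : N) ∈ MulAction.fixedPoints (ConjAct G) N := fun g => smul_one g
  obtain ⟨b, hb, hb1⟩ := (hG.of_equiv ConjAct.toConjAct)
    |>.exists_fixed_point_of_prime_dvd_card_of_fixed_point N hN.symm.dvd hone
  rw [← zpowers_eq_of_prime_card hN b.2 (by simpa using hb1.symm), Subgroup.zpowers_le,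
    Subgroup.mem_center_iff]
  intro g
  have hconj : g * b * g⁻¹ = b := by
    simpa [ConjAct.Subgroup.val_conj_smul, ConjAct.toConjAct_smul] using
      congrArg Subtype.val (hb (ConjAct.toConjAct g))
  exact mul_inv_eq_iff_eq_mul.1 hconj

theorem exponent_eq_prime_or_sq {H : Subgroup G} (hH : Nat.card H = p) (hpow : ∀ g : G, g ^ p ∈ H) :
    Monoid.exponent G = p ∨ Monoid.exponent G = p ^ 2 := by
  have hp : p.Prime := Fact.out
  have hdvd : Monoid.exponent G ∣ p ^ 2 := Monoid.exponent_dvd_of_forall_pow_eq_one fun g => by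
    rw [sq, pow_mul]
    exact orderOf_dvd_iff_pow_eq_one.1 ((H.orderOf_dvd_natCard (hpow g)).trans hH.dvd)
  obtain ⟨a, ha, he⟩ := (Nat.dvd_prime_pow hp).1 hdvd
  interval_cases a
  · have := Monoid.exp_eq_one_iff.1 (he.trans (pow_zero p))
    exact absurd (hH.symm.trans Nat.card_unique) hp.ne_one
  · exact .inl (he.trans (pow_one p))
  · exact .inr he

end PrimeOrder

section Chains

variable {G : Type*} [Group G] [Finite G] {p : ℕ} [Fact p.Prime]

theorem exists_notMem_index_sup_zpowers (hG : IsPGroup p G) {H : Subgroup G} {e : ℕ}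
    (hH : H.index = p ^ (e + 1)) : ∃ g ∉ H, (H ⊔ Subgroup.zpowers g).index = p ^ e := by
  have hp : p.Prime := Fact.out
  obtain ⟨m, hm⟩ := (hG.to_subgroup H).exists_card_eq
  have hcard : Nat.card G = p ^ (m + 1) * p ^ e := by
    rw [← H.card_mul_index, hm, hH]
    ring
  obtain ⟨K, hK, hHK⟩ := Sylow.exists_subgroup_card_pow_succ (Dvd.intro _ hcard.symm) hm
  have hKindex : K.index = p ^ e :=
    Nat.eq_of_mul_eq_mul_left (pow_pos hp.pos (m + 1)) (by rw [← hK, K.card_mul_index, hcard, hK])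
  have hHKindex : H.relIndex K = p := by
    have h := Subgroup.relIndex_mul_index hHK
    rw [hKindex, hH, pow_succ'] at h
    exact Nat.eq_of_mul_eq_mul_right (pow_pos hp.pos e) h
  obtain ⟨g, hgK, hgH⟩ : ∃ g ∈ K, g ∉ H := by
    by_contra! hKH
    exact hp.ne_one (hHKindex.symm.trans (Subgroup.relIndex_eq_one.2 hKH))
  refine ⟨g, hgH, ?_⟩
  have hle : H ⊔ Subgroup.zpowers g ≤ K := sup_le hHK (Subgroup.zpowers_le.2 hgK)
  have hmul := Subgroup.relIndex_mul_relIndex H _ K le_sup_left hle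
  rcases Nat.prime_mul_iff.1 (hmul.trans hHKindex ▸ hp) with ⟨-, h⟩ | ⟨-, h⟩
  · rw [← hKindex, hle.antisymm (Subgroup.relIndex_eq_one.1 h)]
  · have hgH' := Subgroup.relIndex_eq_one.1 h (Subgroup.mem_sup_right (Subgroup.mem_zpowers g))
    exact absurd hgH' hgH

theorem exists_finset_sup_closure_eq_top (hG : IsPGroup p G) {H : Subgroup G} {e : ℕ}
    (hH : H.index = p ^ e) :
    ∃ s : Finset G, s.card ≤ e ∧ H ⊔ Subgroup.closure (s : Set G) = ⊤ := by
  classical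
  induction e generalizing H with
  | zero => exact ⟨∅, by simp, by simpa using hH⟩
  | succ e ih =>
    obtain ⟨g, -, hg⟩ := exists_notMem_index_sup_zpowers hG hH
    obtain ⟨s, hs, hst⟩ := ih hg
    refine ⟨insert g s, (Finset.card_insert_le g s).trans (by omega), ?_⟩
    rw [Finset.coe_insert, Set.insert_eq, Subgroup.closure_union,
      ← Subgroup.zpowers_eq_closure, ← sup_assoc, hst]

end Chains

section RadicalIndex

variable {A : Type*} [Ring A]

theorem le_ringJacobson_of_isNilpotent {I : Ideal A} (hI : ∀ x ∈ I, IsNilpotent x) :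
    I ≤ Ring.jacobson A := by
  intro x hx
  rw [← Ideal.jacobson_bot, Ideal.mem_jacobson_iff]
  intro y
  obtain ⟨u, hu⟩ := (hI _ (I.mul_mem_left y hx)).isUnit_add_one
  refine ⟨(u⁻¹ : Aˣ), ?_⟩
  rw [Ideal.mem_bot, sub_eq_zero, mul_assoc, ← mul_add_one, ← hu, Units.inv_mul]

theorem radicalNilpotencyIndex_eq {I : Ideal A} [I.IsMaximal] {m : ℕ}
    (hbot : I ^ (m + 1) = ⊥) (hne : I ^ m ≠ ⊥) : radicalNilpotencyIndex A = m + 1 := by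
  have hnil : ∀ x ∈ I, IsNilpotent x := fun x hx =>
    ⟨m + 1, Ideal.mem_bot.1 (hbot ▸ Ideal.pow_mem_pow hx (m + 1))⟩
  have hJ : Ring.jacobson A = I :=
    (Ring.jacobson_le_of_isMaximal I).antisymm (le_ringJacobson_of_isNilpotent hnil)
  rw [radicalNilpotencyIndex, hJ]
  refine le_antisymm (Nat.sInf_le ⟨m.succ_pos, hbot⟩) ?_
  refine le_csInf ⟨m + 1, m.succ_pos, hbot⟩ fun s hs => ?_
  by_contra! hlt
  exact hne (eq_bot_iff.2 (hs.2 ▸ Ideal.pow_le_pow_right (Nat.lt_succ_iff.1 hlt)))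

end RadicalIndex

section Collection

open scoped Pointwise

theorem exists_perm_replicate_append {α : Type*} {s : Finset α} {q : ℕ} {l : List α}
    (hl : ∀ x ∈ l, x ∈ s) (hlen : s.card * q < l.length) :
    ∃ x ∈ s, ∃ l', l.Perm (List.replicate (q + 1) x ++ l') := by
  classical
  have hcount : ∑ x ∈ s, l.count x = l.length := by
    simpa using Multiset.sum_count_eq_card (s := s) (m := (l : Multiset α)) (by simpa using hl)
  obtain ⟨x, hx, hlt⟩ : ∃ x ∈ s, q < l.count x := by
    by_contra! h
    exact (hcount ▸ hlen).not_ge (Finset.sum_le_card_nsmul s _ q h)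
  exact ⟨x, hx, (List.replicate_sublist_iff.2 hlt).exists_perm_append⟩

variable {A : Type*} [Ring A] {I Z : Ideal A} {p w : ℕ}

theorem ideal_span_pow (s : Set A) [(Ideal.span s).IsTwoSided] (m : ℕ) :
    Ideal.span s ^ m = Ideal.span (s ^ m) := by
  induction m with
  | zero => simp [Submodule.pow_zero]
  | succ m ih => rw [Ideal.IsTwoSided.pow_succ, ih, Ideal.span_mul_span, pow_succ']

theorem pow_add_mul_le_pow {N : ℕ} (h : ∀ m, N < m → I ^ m ≤ I ^ (m - w) * Z) (j : ℕ) :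
    I ^ (N + 1 + w * j) ≤ Z ^ (j + 1) := by
  induction j with
  | zero =>
    simpa only [mul_zero, add_zero, zero_add, Submodule.pow_one] using
      (h (N + 1) N.lt_succ_self).trans Ideal.mul_le_right
  | succ j ih =>
    calc I ^ (N + 1 + w * (j + 1)) ≤ I ^ (N + 1 + w * (j + 1) - w) * Z := h _ (by omega)
      _ = I ^ (N + 1 + w * j) * Z := by rw [Nat.mul_succ, ← add_assoc, Nat.add_sub_cancel]
      _ ≤ Z ^ (j + 1) * Z := Ideal.mul_mono_left ih
      _ = Z ^ (j + 1 + 1) := (Submodule.pow_succ _).symm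

variable [I.IsTwoSided]

theorem pow_mem_pow_mul {a : A} {i : ℕ} (ha : a ∈ I ^ i) (j : ℕ) : a ^ j ∈ I ^ (i * j) := by
  induction j with
  | zero => simp [Submodule.pow_zero]
  | succ j ih =>
    rw [pow_succ, Nat.mul_succ, Ideal.IsTwoSided.pow_add]
    exact Ideal.mul_mem_mul ih ha

theorem list_prod_mem_pow {l : List A} (hl : ∀ x ∈ l, x ∈ I) : l.prod ∈ I ^ l.length := by
  induction l with
  | nil => simp [Submodule.pow_zero]
  | cons x l ih =>
    rw [List.prod_cons, List.length_cons, Ideal.IsTwoSided.pow_succ]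
    exact Ideal.mul_mem_mul (hl x List.mem_cons_self)
      (ih fun y hy => hl y (List.mem_cons_of_mem x hy))

theorem mul_mem_pow_mul_of_mem_right {a b : A} {i j m : ℕ} (ha : a ∈ I ^ i)
    (hb : b ∈ I ^ j * Z) (hm : m ≤ i + j) : a * b ∈ I ^ m * Z := by
  refine Ideal.mul_mono_left (Ideal.pow_le_pow_right hm) ?_
  rw [Ideal.IsTwoSided.pow_add, mul_assoc]
  exact Ideal.mul_mem_mul ha hb

variable [Z.IsTwoSided]

theorem mul_pow_le_pow_mul (hZ : Z * I ≤ I * Z) (j : ℕ) : Z * I ^ j ≤ I ^ j * Z := by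
  induction j with
  | zero => simp [Submodule.pow_zero]
  | succ j ih =>
    calc Z * I ^ (j + 1) = Z * I * I ^ j := by rw [Ideal.IsTwoSided.pow_succ, mul_assoc]
      _ ≤ I * Z * I ^ j := Ideal.mul_mono_left hZ
      _ = I * (Z * I ^ j) := mul_assoc _ _ _
      _ ≤ I * (I ^ j * Z) := Ideal.mul_mono_right ih
      _ = I ^ (j + 1) * Z := by rw [Ideal.IsTwoSided.pow_succ, mul_assoc]

theorem mul_mem_pow_mul_of_mem_left (hZ : Z * I ≤ I * Z) {a b : A} {i j m : ℕ}
    (ha : a ∈ I ^ i * Z) (hb : b ∈ I ^ j) (hm : m ≤ i + j) : a * b ∈ I ^ m * Z := by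
  have hle : I ^ i * Z * I ^ j ≤ I ^ (i + j) * Z := by
    rw [Ideal.IsTwoSided.pow_add, mul_assoc, mul_assoc]
    exact Ideal.mul_mono_right (mul_pow_le_pow_mul hZ j)
  exact Ideal.mul_mono_left (Ideal.pow_le_pow_right hm) (hle (Ideal.mul_mem_mul ha hb))

theorem prod_sub_prod_mem_of_perm {s : Set A} (hZ : Z * I ≤ I * Z) (hs : s ⊆ I)
    (hcomm : ∀ x ∈ s, ∀ y ∈ s, x * y - y * x ∈ I ^ (2 - w) * Z) {l l' : List A}
    (hl : ∀ x ∈ l, x ∈ s) (h : l.Perm l') : l.prod - l'.prod ∈ I ^ (l.length - w) * Z := by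
  induction h with
  | nil => simp
  | @cons x l l' _ ih =>
    rw [List.forall_mem_cons] at hl
    have hx : x ∈ I ^ 1 := (Submodule.pow_one I).symm ▸ hs hl.1
    rw [List.prod_cons, List.prod_cons, ← mul_sub, List.length_cons]
    exact mul_mem_pow_mul_of_mem_right hx (ih hl.2) (by omega)
  | swap x y l =>
    simp only [List.forall_mem_cons] at hl
    have hprod : l.prod ∈ I ^ l.length := list_prod_mem_pow fun t ht => hs (hl.2.2 t ht)
    simp only [List.prod_cons, List.length_cons, ← mul_assoc, ← sub_mul]
    exact mul_mem_pow_mul_of_mem_left hZ (hcomm y hl.1 x hl.2.1) hprod (by omega)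
  | trans h₁ _ ih₁ ih₂ =>
    rw [← sub_add_sub_cancel]
    exact add_mem (ih₁ hl) (h₁.length_eq ▸ ih₂ fun x hx => hl x (h₁.mem_iff.2 hx))

-- Truncated subtraction is intended: for `m ≤ w` the ideal `I ^ (m - w) * Z` is all of `Z`.
theorem pow_le_pow_mul {s : Finset A} (hI : I = Ideal.span s) (hZ : Z * I ≤ I * Z)
    (hcomm : ∀ x ∈ s, ∀ y ∈ s, x * y - y * x ∈ I ^ (2 - w) * Z) (hp : 0 < p)
    (hpow : ∀ x ∈ s, x ^ p ∈ I ^ (p - w) * Z) {m : ℕ} (hm : s.card * (p - 1) < m) :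
    I ^ m ≤ I ^ (m - w) * Z := by
  have hs : (s : Set A) ⊆ I := hI ▸ Ideal.subset_span
  have hword : ∀ l : List A, l.length = m → (∀ x ∈ l, x ∈ s) → l.prod ∈ I ^ (m - w) * Z := by
    rintro l rfl hl
    obtain ⟨x, hx, l', hperm⟩ := exists_perm_replicate_append hl hm
    rw [Nat.sub_add_cancel hp] at hperm
    have hl' : l'.prod ∈ I ^ l'.length :=
      list_prod_mem_pow fun y hy => hs (hl y (hperm.mem_iff.2 (List.mem_append_right _ hy)))
    have hlen : l.length = p + l'.length := by simpa using hperm.length_eq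
    have hcollected : (List.replicate p x ++ l').prod ∈ I ^ (l.length - w) * Z := by
      rw [List.prod_append, List.prod_replicate]
      exact mul_mem_pow_mul_of_mem_left hZ (hpow x hx) hl' (by omega)
    simpa using add_mem (prod_sub_prod_mem_of_perm hZ hs hcomm hl hperm) hcollected
  have : (Ideal.span (s : Set A)).IsTwoSided := hI ▸ ‹I.IsTwoSided›
  conv_lhs => rw [hI, ideal_span_pow]
  refine Ideal.span_le.2 fun a ha => ?_
  obtain ⟨f, rfl⟩ := Set.mem_pow.1 ha
  exact hword _ (List.length_ofFn) (by simp)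

theorem pow_card_add_mul_eq_bot {s : Finset A} (hI : I = Ideal.span s) (hZ : Z * I ≤ I * Z)
    (hcomm : ∀ x ∈ s, ∀ y ∈ s, x * y - y * x ∈ I ^ (2 - w) * Z) (hp : 0 < p)
    (hpow : ∀ x ∈ s, x ^ p ∈ I ^ (p - w) * Z) (hZp : Z ^ p = ⊥) :
    I ^ ((s.card + w) * (p - 1) + 1) = ⊥ := by
  have h := pow_add_mul_le_pow (fun _ => pow_le_pow_mul hI hZ hcomm hp hpow) (p - 1)
  rw [Nat.sub_add_cancel hp, hZp] at h
  rwa [← le_bot_iff, add_mul, add_right_comm]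

end Collection

section CentralGenerator

variable {A : Type*} [Ring A] {z : A}

theorem isTwoSided_span_singleton_of_mem_center (hz : z ∈ Subring.center A) :
    (Ideal.span {z}).IsTwoSided := by
  refine ⟨fun {a} b ha => ?_⟩
  obtain ⟨c, rfl⟩ := Ideal.mem_span_singleton'.1 ha
  rw [mul_assoc, ← Subring.mem_center_iff.1 hz b, ← mul_assoc]
  exact Ideal.mul_mem_left _ _ (Ideal.mem_span_singleton_self z)

theorem span_singleton_mul_le_of_mem_center (hz : z ∈ Subring.center A) (I : Ideal A) :
    Ideal.span {z} * I ≤ I * Ideal.span {z} := by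
  refine Ideal.mul_le.2 fun a ha b hb => ?_
  obtain ⟨c, rfl⟩ := Ideal.mem_span_singleton'.1 ha
  rw [mul_assoc, ← Subring.mem_center_iff.1 hz b, ← mul_assoc]
  exact Ideal.mul_mem_mul (I.mul_mem_left c hb) (Ideal.mem_span_singleton_self z)

end CentralGenerator

section CharP

variable {p : ℕ} [Fact p.Prime] {A : Type*} [Ring A] [CharP A p]

theorem sub_one_pow_pred_eq_geom_sum (x : A) :
    (x - 1) ^ (p - 1) = ∑ i ∈ Finset.range p, x ^ i := by
  let := ZMod.algebra A p
  have hcyc := Polynomial.cyclotomic_mul_prime_eq_pow_of_not_dvd (ZMod p)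
    (Fact.out : p.Prime).not_dvd_one
  rw [one_mul, Polynomial.cyclotomic_prime, Polynomial.cyclotomic_one] at hcyc
  simpa using (congrArg (Polynomial.aeval x) hcyc).symm

end CharP

open MonoidAlgebra

section AugmentationIdeal

/-- The augmentation ideal of a monoid algebra: the kernel of the algebra homomorphism to the
coefficient ring that sends every element of the monoid to `1`. -/
noncomputable def augmentationIdeal (k G : Type*) [CommRing k] [Monoid G] :
    Ideal (MonoidAlgebra k G) :=
  RingHom.ker (MonoidAlgebra.lift k k G 1)

instance (k G : Type*) [CommRing k] [Monoid G] : (augmentationIdeal k G).IsTwoSided :=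
  inferInstanceAs (RingHom.ker (MonoidAlgebra.lift k k G 1)).IsTwoSided

instance (k G : Type*) [Field k] [Monoid G] : (augmentationIdeal k G).IsMaximal :=
  RingHom.ker_isMaximal_of_surjective (MonoidAlgebra.lift k k G 1) fun c =>
    ⟨algebraMap k _ c, AlgHom.commutes _ c⟩

theorem of_sub_one_mem_augmentationIdeal (k : Type*) {G : Type*} [CommRing k] [Monoid G] (g : G) :
    of k G g - 1 ∈ augmentationIdeal k G := by
  rw [augmentationIdeal, RingHom.mem_ker, map_sub, lift_of, map_one, MonoidHom.one_apply, sub_self]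

variable (k : Type*) {G : Type*} [CommRing k] [Group G]

theorem of_sub_one_mem_span_of_mem_closure {s : Set G} {g : G} (hg : g ∈ Subgroup.closure s) :
    of k G g - 1 ∈ Ideal.span ((fun x => of k G x - 1) '' s) := by
  induction hg using Subgroup.closure_induction with
  | mem x hx => exact Ideal.subset_span (Set.mem_image_of_mem _ hx)
  | one =>
    rw [map_one, sub_self]
    exact zero_mem _
  | mul x y _ _ hx hy =>
    have hxy : of k G (x * y) - 1 = of k G x * (of k G y - 1) + (of k G x - 1) := by
      rw [map_mul]
      noncomm_ring
    exact hxy ▸ add_mem (Ideal.mul_mem_left _ _ hy) hx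
  | inv x _ hx =>
    have hinv : of k G x⁻¹ - 1 = -(of k G x⁻¹ * (of k G x - 1)) := by
      rw [mul_sub, ← map_mul, inv_mul_cancel, map_one, mul_one, neg_sub]
    exact hinv ▸ neg_mem (Ideal.mul_mem_left _ _ hx)

theorem of_sub_one_mem_span_singleton_of_mem_zpowers {y z : G} (hy : y ∈ Subgroup.zpowers z) :
    of k G y - 1 ∈ Ideal.span {of k G z - 1} := by
  rw [Subgroup.zpowers_eq_closure] at hy
  simpa only [Set.image_singleton] using of_sub_one_mem_span_of_mem_closure k hy

theorem sub_algebraMap_mem_span (f : MonoidAlgebra k G) :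
    f - algebraMap k _ (MonoidAlgebra.lift k k G 1 f) ∈
      Ideal.span (Set.range fun g : G => of k G g - 1) := by
  induction f using MonoidAlgebra.induction_on with
  | of g =>
    rw [lift_of, MonoidHom.one_apply, map_one]
    exact Ideal.subset_span (Set.mem_range_self g)
  | add f g hf hg =>
    rw [map_add, map_add, add_sub_add_comm]
    exact add_mem hf hg
  | smul r f hf =>
    rw [map_smul, smul_eq_mul, map_mul, Algebra.smul_def, ← mul_sub]
    exact Ideal.mul_mem_left _ _ hf

theorem augmentationIdeal_eq_span {s : Set G} (hs : Subgroup.closure s = ⊤) :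
    augmentationIdeal k G = Ideal.span ((fun g => of k G g - 1) '' s) := by
  apply le_antisymm
  · intro f hf
    have hf_span := sub_algebraMap_mem_span k f
    rw [RingHom.mem_ker.1 hf, map_zero, sub_zero] at hf_span
    refine Ideal.span_le.2 ?_ hf_span
    rintro _ ⟨g, rfl⟩
    exact of_sub_one_mem_span_of_mem_closure k (hs ▸ Subgroup.mem_top g)
  · rw [Ideal.span_le]
    rintro _ ⟨g, -, rfl⟩
    exact of_sub_one_mem_augmentationIdeal k g

theorem of_mem_center {z : G} (hz : z ∈ Subgroup.center G) :
    of k G z ∈ Subring.center (MonoidAlgebra k G) := by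
  refine Subring.mem_center_iff.2 fun a => ?_
  induction a using MonoidAlgebra.induction_on with
  | of g => rw [← map_mul, ← map_mul, Subgroup.mem_center_iff.1 hz g]
  | add f g hf hg => rw [mul_add, add_mul, hf, hg]
  | smul r f hf => rw [mul_smul_comm, smul_mul_assoc, hf]

open scoped commutatorElement in
theorem of_sub_one_mul_sub_mul_of_sub_one (g h : G) :
    (of k G g - 1) * (of k G h - 1) - (of k G h - 1) * (of k G g - 1) =
      (of k G ⁅g, h⁆ - 1) * of k G (h * g) := by
  have hgh : of k G ⁅g, h⁆ * of k G (h * g) = of k G (g * h) := by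
    rw [← map_mul, commutatorElement_def]
    group
  rw [sub_mul (of k G ⁅g, h⁆), one_mul, hgh, map_mul, map_mul]
  noncomm_ring

open scoped commutatorElement in
theorem of_commutatorElement_sub_one_mem_sq (g h : G) :
    of k G ⁅g, h⁆ - 1 ∈ augmentationIdeal k G ^ 2 := by
  have hmem := of_sub_one_mem_augmentationIdeal k (G := G)
  have hmul : (of k G ⁅g, h⁆ - 1) * of k G (h * g) ∈ augmentationIdeal k G ^ 2 := by
    rw [← of_sub_one_mul_sub_mul_of_sub_one, Submodule.pow_succ, Submodule.pow_one]
    exact sub_mem (Ideal.mul_mem_mul (hmem g) (hmem h)) (Ideal.mul_mem_mul (hmem h) (hmem g))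
  have hcancel : of k G (h * g) * of k G (h * g)⁻¹ = 1 := by
    rw [← map_mul, mul_inv_cancel, map_one]
  simpa only [mul_assoc, hcancel, mul_one] using
    Ideal.mul_mem_right (of k G (h * g)⁻¹) _ hmul

end AugmentationIdeal

section PrimeCharacteristic

variable (k : Type*) {G : Type*} [CommRing k] [Group G] {p : ℕ} [CharP k p]

theorem of_sub_one_pow_char [Fact p.Prime] (g : G) : (of k G g - 1) ^ p = of k G (g ^ p) - 1 := by
  have := charP_of_injective_algebraMap' k (A := MonoidAlgebra k G) p
  rw [sub_pow_char_of_commute _ (Commute.one_right _), one_pow, map_pow]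

end PrimeCharacteristic

section SubgroupSum

/-- The sum in the monoid algebra of the elements of a subgroup `H`; it is only meaningful for
finite `H`, and is `0` otherwise. -/
noncomputable def subgroupSum (k : Type*) {G : Type*} [CommRing k] [Group G] (H : Subgroup G) :
    MonoidAlgebra k G :=
  ∑ᶠ h : H, of k G h

variable (k : Type*) {G : Type*} [CommRing k] [Group G] {H K : Subgroup G} {g : G} {p : ℕ}

theorem subgroupSum_ne_zero [Nontrivial k] (H : Subgroup G) [Finite H] : subgroupSum k H ≠ 0 := by
  classical
  have := Fintype.ofFinite H
  intro h
  have hcoeff : (subgroupSum k H).coeff 1 = 1 := by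
    simp [subgroupSum, finsum_eq_sum_of_fintype, Finsupp.single_apply]
  simp [h] at hcoeff

theorem injOn_mk_pow [Fact p.Prime] (hg : g ∉ H) (hgp : g ^ p ∈ H) :
    Set.InjOn (fun i : ℕ => ((g ^ i : G) : G ⧸ H)) (Set.Iio p) := by
  have hiter (i : ℕ) : (g • ·)^[i] ((1 : G) : G ⧸ H) = ((g ^ i : G) : G ⧸ H) := by
    rw [smul_iterate]
    exact congrArg QuotientGroup.mk (mul_one (g ^ i))
  have hperiod : Function.minimalPeriod (g • ·) ((1 : G) : G ⧸ H) = p := by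
    refine Function.minimalPeriod_eq_prime ?_ fun hfix => hg ?_
    · rw [Function.IsPeriodicPt, Function.IsFixedPt, hiter]
      simpa [QuotientGroup.eq] using hgp
    · have h := (hiter 1).symm.trans hfix
      simpa [QuotientGroup.eq] using h
  simpa only [hperiod, hiter] using
    Function.iterate_injOn_Iio_minimalPeriod (f := (g • ·)) (x := ((1 : G) : G ⧸ H))

theorem bijective_pow_mul [Fact p.Prime] [Finite K] (hHK : H ≤ K) (hindex : H.relIndex K = p)
    (hgK : g ∈ K) (hgH : g ∉ H) (hgp : g ^ p ∈ H) :
    Function.Bijective fun x : Fin p × H =>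
      (⟨g ^ (x.1 : ℕ) * x.2, mul_mem (pow_mem hgK _) (hHK x.2.2)⟩ : K) := by
  refine (Nat.bijective_iff_injective_and_card _).2 ⟨?_, ?_⟩
  · rintro ⟨i, h⟩ ⟨j, h'⟩ heq
    have hmul : g ^ (i : ℕ) * h = g ^ (j : ℕ) * h' := congrArg Subtype.val heq
    have hcoset : ((g ^ (i : ℕ) : G) : G ⧸ H) = ((g ^ (j : ℕ) : G) : G ⧸ H) := by
      rw [← QuotientGroup.mk_mul_of_mem _ h.2, hmul, QuotientGroup.mk_mul_of_mem _ h'.2]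
    obtain rfl : i = j := Fin.ext (injOn_mk_pow hgH hgp i.2 j.2 hcoset)
    rw [Subtype.ext (mul_left_cancel hmul)]
  · have hcard := Subgroup.relIndex_mul_relIndex ⊥ H K bot_le hHK
    rw [Subgroup.relIndex_bot_left, Subgroup.relIndex_bot_left, hindex] at hcard
    rw [Nat.card_prod, Nat.card_fin, mul_comm, hcard]

theorem subgroupSum_eq_geom_sum_mul [Fact p.Prime] [Finite K] (hHK : H ≤ K)
    (hindex : H.relIndex K = p) (hgK : g ∈ K) (hgH : g ∉ H) (hgp : g ^ p ∈ H) :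
    subgroupSum k K = (∑ i ∈ Finset.range p, of k G g ^ i) * subgroupSum k H := by
  have : Finite H := Finite.of_injective _ (Subgroup.inclusion_injective hHK)
  have := Fintype.ofFinite H
  rw [subgroupSum, subgroupSum, ← finsum_comp _ (bijective_pow_mul hHK hindex hgK hgH hgp),
    finsum_eq_sum_of_fintype, finsum_eq_sum_of_fintype, ← Fin.sum_univ_eq_sum_range,
    Finset.sum_mul_sum, Fintype.sum_prod_type]
  simp only [map_mul, map_pow]

end SubgroupSum

section NilpotencyBounds

variable {k : Type*} {G : Type*} [CommRing k] [Group G] {p w e : ℕ} [Fact p.Prime] [CharP k p]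

theorem subgroupSum_mem_pow_of_sup_zpowers [Finite G] {H : Subgroup G} {g : G} {m : ℕ}
    (hindex : H.relIndex (H ⊔ Subgroup.zpowers g) = p) (hg : g ∉ H) (hgp : g ^ p ∈ H)
    (hmem : of k G g - 1 ∈ augmentationIdeal k G ^ w)
    (hH : subgroupSum k H ∈ augmentationIdeal k G ^ m) :
    subgroupSum k (H ⊔ Subgroup.zpowers g) ∈ augmentationIdeal k G ^ (w * (p - 1) + m) := by
  have := charP_of_injective_algebraMap' k (A := MonoidAlgebra k G) p
  rw [subgroupSum_eq_geom_sum_mul k le_sup_left hindex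
    (Subgroup.mem_sup_right (Subgroup.mem_zpowers g)) hg hgp, ← sub_one_pow_pred_eq_geom_sum,
    Ideal.IsTwoSided.pow_add]
  exact Ideal.mul_mem_mul (pow_mem_pow_mul hmem _) hH

theorem subgroupSum_top_mem_pow [Finite G] (hG : IsPGroup p G) {H : Subgroup G} {m : ℕ}
    (hindex : H.index = p ^ e) (hpow : ∀ g : G, g ^ p ∈ H)
    (hH : subgroupSum k H ∈ augmentationIdeal k G ^ m) :
    subgroupSum k (⊤ : Subgroup G) ∈ augmentationIdeal k G ^ (e * (p - 1) + m) := by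
  induction e generalizing H m with
  | zero =>
    rw [← Subgroup.index_eq_one.1 (hindex.trans (pow_zero p)), zero_mul, zero_add]
    exact hH
  | succ e ih =>
    obtain ⟨g, hg, hgindex⟩ := exists_notMem_index_sup_zpowers hG hindex
    have hrel : H.relIndex (H ⊔ Subgroup.zpowers g) = p := by
      have h := Subgroup.relIndex_mul_index (le_sup_left : H ≤ H ⊔ Subgroup.zpowers g)
      rw [hgindex, hindex, pow_succ'] at h
      exact Nat.eq_of_mul_eq_mul_right (pow_pos (Fact.out : p.Prime).pos e) h
    have hmem : of k G g - 1 ∈ augmentationIdeal k G ^ 1 := by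
      rw [Submodule.pow_one]
      exact of_sub_one_mem_augmentationIdeal k g
    have hsum := subgroupSum_mem_pow_of_sup_zpowers hrel hg (hpow g) hmem hH
    convert ih hgindex (fun x => Subgroup.mem_sup_left (hpow x)) hsum using 2
    ring

theorem augmentationIdeal_pow_ne_bot [Finite G] [Nontrivial k] (hG : IsPGroup p G) {z : G}
    (hz : orderOf z = p) (hindex : (Subgroup.zpowers z).index = p ^ e)
    (hpow : ∀ g : G, g ^ p ∈ Subgroup.zpowers z)
    (hzw : of k G z - 1 ∈ augmentationIdeal k G ^ w) :
    augmentationIdeal k G ^ ((e + w) * (p - 1)) ≠ ⊥ := by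
  have hbot : subgroupSum k (⊥ : Subgroup G) ∈ augmentationIdeal k G ^ 0 := by
    simp [Submodule.pow_zero]
  have hz_notMem : z ∉ (⊥ : Subgroup G) := fun h =>
    (Fact.out : p.Prime).ne_one (hz ▸ orderOf_eq_one_iff.2 (Subgroup.mem_bot.1 h))
  have hz_pow : z ^ p ∈ (⊥ : Subgroup G) := Subgroup.mem_bot.2 (hz ▸ pow_orderOf_eq_one z)
  have hrel : (⊥ : Subgroup G).relIndex (⊥ ⊔ Subgroup.zpowers z) = p := by
    rw [bot_sup_eq, Subgroup.relIndex_bot_left, Nat.card_zpowers, hz]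
  have hsum := subgroupSum_mem_pow_of_sup_zpowers hrel hz_notMem hz_pow hzw hbot
  rw [bot_sup_eq] at hsum
  have htop := subgroupSum_top_mem_pow hG hindex hpow hsum
  rw [add_zero, ← add_mul] at htop
  exact fun h => subgroupSum_ne_zero k ⊤ (Ideal.mem_bot.1 (h ▸ htop))

theorem augmentationIdeal_pow_eq_bot {s : Finset G} (hs : Subgroup.closure (s : Set G) = ⊤)
    {z : G} (hz : z ∈ Subgroup.center G) (hzp : z ^ p = 1)
    (hcomm : commutator G ≤ Subgroup.zpowers z) (hw : 2 ≤ w)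
    (hpow : ∀ g ∈ s, g ^ p = 1 ∨ g ^ p ∈ Subgroup.zpowers z ∧ p ≤ w) :
    augmentationIdeal k G ^ ((s.card + w) * (p - 1) + 1) = ⊥ := by
  classical
  set I := augmentationIdeal k G
  let Z : Ideal (MonoidAlgebra k G) := Ideal.span {of k G z - 1}
  have hcenter : of k G z - 1 ∈ Subring.center (MonoidAlgebra k G) :=
    sub_mem (of_mem_center k hz) (one_mem _)
  have hZ_twoSided : Z.IsTwoSided := isTwoSided_span_singleton_of_mem_center hcenter
  have hZ : Z * I ≤ I * Z := span_singleton_mul_le_of_mem_center hcenter I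
  have hzpowers {y : G} (hy : y ∈ Subgroup.zpowers z) {m : ℕ} (hm : m ≤ w) :
      of k G y - 1 ∈ I ^ (m - w) * Z := by
    rw [Nat.sub_eq_zero_of_le hm, Submodule.pow_zero, Ideal.one_eq_top, Ideal.top_mul]
    exact of_sub_one_mem_span_singleton_of_mem_zpowers k hy
  have hZp : Z ^ p = ⊥ := by
    rw [Ideal.span_singleton_pow, of_sub_one_pow_char, hzp, map_one, sub_self,
      Ideal.span_singleton_zero]
  let S : Finset (MonoidAlgebra k G) := s.image fun g => of k G g - 1
  have hI : I = Ideal.span S := by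
    rw [Finset.coe_image]
    exact augmentationIdeal_eq_span k hs
  have hSpow : ∀ x ∈ S, x ^ p ∈ I ^ (p - w) * Z := by
    refine Finset.forall_mem_image.2 fun g hg => ?_
    rw [of_sub_one_pow_char]
    rcases hpow g hg with h | ⟨h, hpw⟩
    · rw [h, map_one, sub_self]
      exact zero_mem _
    · exact hzpowers h hpw
  have hScomm : ∀ x ∈ S, ∀ y ∈ S, x * y - y * x ∈ I ^ (2 - w) * Z := by
    refine Finset.forall_mem_image.2 fun g _ => Finset.forall_mem_image.2 fun h _ => ?_
    rw [of_sub_one_mul_sub_mul_of_sub_one]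
    exact Ideal.mul_mem_right _ _ (hzpowers (hcomm (Subgroup.commutator_mem_commutator
      (Subgroup.mem_top g) (Subgroup.mem_top h))) hw)
  refine le_bot_iff.1 (le_trans (Ideal.pow_le_pow_right ?_)
    (pow_card_add_mul_eq_bot hI hZ hScomm (Fact.out : p.Prime).pos hSpow hZp).le)
  gcongr
  exact Finset.card_image_le

end NilpotencyBounds

section FrattiniOfPrimeOrder

variable (k : Type*) [Field k] {G : Type*} [Group G] [Finite G] {p e : ℕ} [Fact p.Prime]
  [CharP k p]

theorem groupNilpotencyIndex_eq_of_weight (hG : IsPGroup p G) (hΦ : Nat.card (frattini G) = p)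
    (hindex : (frattini G).index = p ^ e) {z : G} (hz : z ∈ frattini G) (hz1 : z ≠ 1) {w : ℕ}
    (hw : 2 ≤ w) (hzw : of k G z - 1 ∈ augmentationIdeal k G ^ w)
    (hpow : ∀ g : G, g ^ p = 1 ∨ p ≤ w) :
    groupNilpotencyIndex k G = (e + w) * (p - 1) + 1 := by
  have := hG.isNilpotent
  have hzpowers : Subgroup.zpowers z = frattini G := zpowers_eq_of_prime_card hΦ hz hz1
  have horder : orderOf z = p := by rw [← Nat.card_zpowers, hzpowers, hΦ]
  have hpow_mem (g : G) : g ^ p ∈ Subgroup.zpowers z := hzpowers ▸ pow_mem_frattini hG g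
  obtain ⟨s, hs, hsup⟩ := exists_finset_sup_closure_eq_top hG hindex
  have hgen : Subgroup.closure (s : Set G) = ⊤ :=
    frattini_nongenerating ((sup_comm _ _).trans hsup)
  have hupper := augmentationIdeal_pow_eq_bot (k := k) hgen (le_center_of_card_eq hG hΦ hz)
    (horder ▸ pow_orderOf_eq_one z) (hzpowers ▸ commutator_le_frattini) hw
    fun g _ => (hpow g).imp_right fun h => ⟨hpow_mem g, h⟩
  refine radicalNilpotencyIndex_eq (I := augmentationIdeal k G) ?_
    (augmentationIdeal_pow_ne_bot hG horder (hzpowers ▸ hindex) hpow_mem hzw)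
  refine le_bot_iff.1 ((Ideal.pow_le_pow_right ?_).trans hupper.le)
  gcongr

theorem groupNilpotencyIndex_eq_of_exponent_eq_prime (hΦ : Nat.card (frattini G) = p)
    (hindex : (frattini G).index = p ^ e) (hexp : Monoid.exponent G = p) :
    groupNilpotencyIndex k G = (e + 2) * (p - 1) + 1 := by
  have hpow (g : G) : g ^ p = 1 := hexp ▸ Monoid.pow_exponent_eq_one g
  have hG : IsPGroup p G := fun g => ⟨1, by rw [pow_one, hpow]⟩
  have := hG.isNilpotent
  have hne : frattini G ≠ ⊥ := fun h =>
    (Fact.out : p.Prime).ne_one (hΦ.symm.trans (h ▸ Subgroup.card_bot))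
  obtain ⟨g, h, hgh⟩ := exists_commutatorElement_ne_one hpow hne
  have hmem := commutator_le_frattini (Subgroup.commutator_mem_commutator
    (Subgroup.mem_top g) (Subgroup.mem_top h))
  exact groupNilpotencyIndex_eq_of_weight k hG hΦ hindex hmem hgh le_rfl
    (of_commutatorElement_sub_one_mem_sq k g h) fun x => .inl (hpow x)

theorem groupNilpotencyIndex_eq_of_exponent_eq_sq (hΦ : Nat.card (frattini G) = p)
    (hindex : (frattini G).index = p ^ e) (hexp : Monoid.exponent G = p ^ 2) :
    groupNilpotencyIndex k G = (e + p) * (p - 1) + 1 := by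
  have hp : p.Prime := Fact.out
  have hG : IsPGroup p G := fun g => ⟨2, hexp ▸ Monoid.pow_exponent_eq_one g⟩
  have := hG.isNilpotent
  obtain ⟨g, hg⟩ : ∃ g : G, g ^ p ≠ 1 := by
    by_contra! h
    have hdvd := Monoid.exponent_dvd_of_forall_pow_eq_one h
    rw [hexp, sq] at hdvd
    exact hp.one_lt.not_ge (Nat.le_of_mul_le_mul_left
      ((Nat.le_of_dvd hp.pos hdvd).trans_eq (mul_one p).symm) hp.pos)
  have hmem : of k G (g ^ p) - 1 ∈ augmentationIdeal k G ^ p :=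
    of_sub_one_pow_char k (p := p) g ▸
      Ideal.pow_mem_pow (of_sub_one_mem_augmentationIdeal k g) p
  exact groupNilpotencyIndex_eq_of_weight k hG hΦ hindex (pow_mem_frattini hG g) hg hp.two_le hmem
    fun _ => .inr le_rfl

end FrattiniOfPrimeOrder

theorem lemma4p1 {p n : ℕ} (hp : p.Prime)
    (k : Type*) [Field k] [CharP k p]
    (G : Type*) [Group G] (hG : Nat.card G = p ^ n) (hΦ : Nat.card (frattini G) = p) :
    (Monoid.exponent G = p ∨ Monoid.exponent G = p ^ 2) ∧
    (Monoid.exponent G = p → groupNilpotencyIndex k G = (n + 1) * (p - 1) + 1) ∧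
    (Monoid.exponent G = p ^ 2 → groupNilpotencyIndex k G = (p + n - 1) * (p - 1) + 1) ∧
    (p = 2 → groupNilpotencyIndex k G = n + 2) := by
  have : Fact p.Prime := ⟨hp⟩
  have : Finite G := Nat.finite_of_card_ne_zero (hG ▸ pow_ne_zero n hp.ne_zero)
  have hpG : IsPGroup p G := IsPGroup.of_card hG
  have := hpG.isNilpotent
  obtain ⟨e, hindex⟩ := hpG.index (frattini G)
  obtain rfl : e + 1 = n := Nat.pow_right_injective hp.two_le <| by
    simp only [← hG, ← (frattini G).card_mul_index, hΦ, hindex, pow_succ']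
  have hexp := exponent_eq_prime_or_sq hΦ (pow_mem_frattini hpG)
  have h₁ (h : Monoid.exponent G = p) : groupNilpotencyIndex k G = (e + 2) * (p - 1) + 1 :=
    groupNilpotencyIndex_eq_of_exponent_eq_prime k hΦ hindex h
  have h₂ (h : Monoid.exponent G = p ^ 2) : groupNilpotencyIndex k G = (p + e) * (p - 1) + 1 :=
    add_comm p e ▸ groupNilpotencyIndex_eq_of_exponent_eq_sq k hΦ hindex h
  refine ⟨hexp, h₁, h₂, ?_⟩
  rintro rfl
  rcases hexp with h | h
  · rw [h₁ h]
    omega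
  · rw [h₂ h]
    omega
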